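/- Let $0<r_e<r_a<r_s$, $\lambda,\mu\ge 0$, and put $\bar\varphi=\arccos(r_e/r_a)+\arccos(r_e/r_s)$; assume $\bar\varphi\le\pi/2$. Let $\Xi=\sum_i\delta_{(\theta_i,\phi_i)}$ be a Poisson point process on $[0,\pi)\times[0,\pi)$ with density $\lambda\sin(\phi)/(2\pi)$; each point $(\theta_i,\phi_i)$ represents the orbit $l(\theta_i,\phi_i)\subset\mathbb R^3$, the great circle of radius $r_s$ centred at the origin with longitude $\theta_i$ and inclination $\phi_i$. Let the satellites form a Cox point process $\Psi$: conditionally on $\Xi$ they are a Poisson point process with intensity $\mu/(2\pi r_s)$ with respect to arc length on each of the orbits. The typical aerial platform is $A=(0,0,r_a)$, and the extended spherical cap is the set of points $x$ with $\|x\|=r_s$ and $\|x-A\|\le|\overline{AC}|$, where $|\overline{AC}|=\sqrt{r_s^2+r_a^2-2r_sr_a\cos\bar\varphi}$. Let $D$ be the distance from $A$ to the nearest satellite in the extended spherical cap, with $D=\infty$ if there is none. Then $D$ is (up to a null set) a random variable, and for every real $d$: 1. if $d\le r_s-r_a$, then $\mathbb P(D>d)=1$; 2. if $r_s-r_a<d\le|\overline{AC}|$,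 then $$\mathbb P(D>d)=\exp\left(-\lambda\int_0^{\zeta(d)}\cos\varphi\left(1-e^{-\frac{\mu}{\pi}\arcsin\sqrt{1-\cos^2(\zeta(d))\sec^2\varphi}}\right)d\varphi\right),\qquad \zeta(d)=\arccos\frac{r_s^2+r_a^2-d^2}{2r_sr_a};$$ 3. if $d>|\overline{AC}|$, then $\mathbb P(D>d)$ is the probability that there is no satellite in the extended spherical cap, and $$\mathbb P(D>d)=\exp\left(-\lambda\int_0^{\bar\varphi}\cos\varphi\left(1-e^{-\frac{\mu}{\pi}\arcsin\sqrt{1-\cos^2(\bar\varphi)\sec^2\varphi}}\right)d\varphi\right).$$ -/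

import Mathlib

open MeasureTheory ProbabilityTheory

/-- Three-dimensional Euclidean space. -/
abbrev Space : Type := EuclideanSpace ℝ (Fin 3)

/-- `ν` is a counting measure `∑ δ_{x_i}` with at most countably many (possibly repeated) points. -/
def IsCountingMeasure {E : Type*} [MeasurableSpace E] (ν : Measure E) : Prop :=
  ∃ (s : Set ℕ) (x : ℕ → E), ν = Measure.sum fun i : s => Measure.dirac (x i)

/-- A point process: a random measure which is almost surely a counting measure. -/
structure IsPointProcess {Ω E : Type*} [MeasurableSpace Ω] [MeasurableSpace E]
    (P : Measure Ω) (N : Ω → Measure E) : Prop where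
  measurable : Measurable N
  counting : ∀ᵐ ω ∂P, IsCountingMeasure (N ω)

/-- The probability that a Poisson variable of mean `r ∈ [0, ∞]` takes the value `k : ℕ`
(a Poisson variable of infinite mean is almost surely infinite). -/
noncomputable def poissonMass (r : ENNReal) (k : ℕ) : ℝ :=
  if r = ⊤ then 0 else (poissonMeasure r.toNNReal).real {k}

/-- `N` is a Poisson point process with intensity measure `Λ`: the numbers of points in disjoint
measurable sets `B i` are independent Poisson variables with means `Λ (B i)`. -/
structure IsPoissonPointProcess {Ω E : Type*} [MeasurableSpace Ω] [MeasurableSpace E]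
    (P : Measure Ω) (N : Ω → Measure E) (Λ : Measure E) : Prop where
  isPointProcess : IsPointProcess P N
  counts : ∀ (n : ℕ) (B : Fin n → Set E) (k : Fin n → ℕ), (∀ i, MeasurableSet (B i)) →
    Pairwise (fun i j => Disjoint (B i) (B j)) →
    P.real {ω | ∀ i, N ω (B i) = (k i : ENNReal)} = ∏ i, poissonMass (Λ (B i)) (k i)

/-- `N` is a Cox point process driven by `Ξ`: conditionally on (the sigma-algebra generated by) the
random measure `Ξ`, it is a Poisson point process with intensity measure `Λ (Ξ ω)`. -/
structure IsCoxPointProcess {Ω F E : Type*} [MeasurableSpace Ω] [MeasurableSpace F]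
    [MeasurableSpace E] (P : Measure Ω) (Ξ : Ω → Measure F) (N : Ω → Measure E)
    (Λ : Measure F → Measure E) : Prop where
  isPointProcess : IsPointProcess P N
  counts : ∀ (n : ℕ) (B : Fin n → Set E) (k : Fin n → ℕ), (∀ i, MeasurableSet (B i)) →
    Pairwise (fun i j => Disjoint (B i) (B j)) →
    P⟦{ω | ∀ i, N ω (B i) = (k i : ENNReal)} | MeasurableSpace.comap Ξ inferInstance⟧
      =ᵐ[P] fun ω => ∏ i, poissonMass (Λ (Ξ ω) (B i)) (k i)

/-- The intensity measure `lam * sin φ / (2 π) dθ dφ` on `[0, π) × [0, π)` of the orbit process,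
where the orbit `(θ, φ)` has longitude `θ` and inclination `φ`. -/
noncomputable def orbitIntensity (lam : ℝ) : Measure (ℝ × ℝ) :=
  (volume.restrict (Set.Ico 0 Real.pi ×ˢ Set.Ico 0 Real.pi)).withDensity
    fun p => ENNReal.ofReal (lam * Real.sin p.2 / (2 * Real.pi))

/-- The point with argument angle `w` on the orbit of radius `rs` with longitude `p.1` and
inclination `p.2`: the orbit is the great circle obtained from the equator by a rotation of angle
`p.2` about the `x`-axis followed by a rotation of angle `p.1` about the `z`-axis. -/
noncomputable def orbitPoint (rs : ℝ) (p : ℝ × ℝ) (w : ℝ) : Space :=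
  !₂[rs * (Real.cos w * Real.cos p.1 - Real.sin w * Real.cos p.2 * Real.sin p.1),
     rs * (Real.cos w * Real.sin p.1 + Real.sin w * Real.cos p.2 * Real.cos p.1),
     rs * (Real.sin w * Real.sin p.2)]

theorem measurable_orbitPoint (rs : ℝ) :
    Measurable fun q : (ℝ × ℝ) × ℝ => orbitPoint rs q.1 q.2 := by
  unfold orbitPoint
  have : Continuous fun q : (ℝ × ℝ) × ℝ =>
      ![rs * (Real.cos q.2 * Real.cos q.1.1 - Real.sin q.2 * Real.cos q.1.2 * Real.sin q.1.1),
        rs * (Real.cos q.2 * Real.sin q.1.1 + Real.sin q.2 * Real.cos q.1.2 * Real.cos q.1.1),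
        rs * (Real.sin q.2 * Real.sin q.1.2)] := by
    refine continuous_pi fun i => ?_
    fin_cases i <;> simp <;> fun_prop
  exact ((PiLp.continuous_toLp 2 _).comp this).measurable

theorem measurable_orbitArcLength (rs : ℝ) : Measurable fun p : ℝ × ℝ => ENNReal.ofReal rs •
    (volume.restrict (Set.Ico 0 (2 * Real.pi))).map (orbitPoint rs p) := by
  have key : ∀ (ν : Measure ℝ) [SFinite ν] (f : ℝ × ℝ → ℝ → Space) (c : ENNReal),
      (Measurable fun q : (ℝ × ℝ) × ℝ => f q.1 q.2) → Measurable fun p => c • ν.map (f p) := by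
    intro ν _ f c hf
    refine Measure.measurable_of_measurable_coe _ fun B hB => ?_
    have h (p : ℝ × ℝ) : Measurable (f p) := hf.comp measurable_prodMk_left
    have hm := measurable_measure_prodMk_left (ν := ν) (hf hB)
    have he : (fun p : ℝ × ℝ => (c • ν.map (f p)) B) = fun p => c * ν
        (Prod.mk p ⁻¹' ((fun q : (ℝ × ℝ) × ℝ => f q.1 q.2) ⁻¹' B)) := by
      funext p
      rw [Measure.smul_apply, Measure.map_apply (h p) hB, smul_eq_mul]
      rfl
    rw [he]
    exact hm.const_mul c
  exact key _ (orbitPoint rs) _ (measurable_orbitPoint rs)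

/-- The arc length measure on an orbit of radius `rs` (arc length is `rs` times the argument angle),
as a measurable function of the orbit parameters `(θ, φ)`. -/
noncomputable def orbitArcLength (rs : ℝ) : Kernel (ℝ × ℝ) Space where
  toFun p := ENNReal.ofReal rs •
    (volume.restrict (Set.Ico 0 (2 * Real.pi))).map (orbitPoint rs p)
  measurable' := measurable_orbitArcLength rs

/-- Given an orbit configuration `ξ = ∑ δ_{(θ_i, φ_i)}`, the intensity measure of the satellites:
density `mu / (2 π rs)` with respect to arc length on each orbit, summed over the orbits. -/
noncomputable def satelliteIntensity (mu rs : ℝ) (ξ : Measure (ℝ × ℝ)) : Measure Space :=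
  ENNReal.ofReal (mu / (2 * Real.pi * rs)) • ξ.bind (orbitArcLength rs)

/-- The satellite network: `Ξ` is the Poisson process of orbits and `Ψ` the Cox process of
satellites on these orbits; `lam` is the mean number of orbits and `mu` the mean number of
satellites per orbit. -/
structure IsSatelliteNetwork {Ω : Type*} [MeasurableSpace Ω] (P : Measure Ω) (lam mu rs : ℝ)
    (Ξ : Ω → Measure (ℝ × ℝ)) (Ψ : Ω → Measure Space) : Prop where
  orbits : IsPoissonPointProcess P Ξ (orbitIntensity lam)
  satellites : IsCoxPointProcess P Ξ Ψ (satelliteIntensity mu rs)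

/-- The position `A = (0, 0, ra)` of the typical aerial platform. -/
noncomputable def platform (ra : ℝ) : Space := !₂[0, 0, ra]

/-- The points of the sphere of radius `rs` at distance at most `d` from `X`. -/
def sphericalCap (rs : ℝ) (X : Space) (d : ℝ) : Set Space :=
  {x | ‖x‖ = rs ∧ dist x X ≤ d}

/-- The central angle `arccos (re / ra) + arccos (re / rs)` of the extended spherical cap. -/
noncomputable def capAngle (re ra rs : ℝ) : ℝ :=
  Real.arccos (re / ra) + Real.arccos (re / rs)

/-- The maximal distance `|AC|` between the platform and a satellite in the extended cap. -/
noncomputable def capRadius (re ra rs : ℝ) : ℝ :=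
  √(rs ^ 2 + ra ^ 2 - 2 * rs * ra * Real.cos (capAngle re ra rs))

/-- The extended spherical cap: the part of the satellite sphere visible from the platform. -/
noncomputable def extendedCap (re ra rs : ℝ) : Set Space :=
  sphericalCap rs (platform ra) (capRadius re ra rs)

/-- The distance from the typical platform to the nearest satellite (atom of `ψ`) in the extended
spherical cap, and `∞` if there is no such satellite. -/
noncomputable def nearestDist (re ra rs : ℝ) (ψ : Measure Space) : EReal :=
  ⨅ x ∈ {x | ψ {x} ≠ 0} ∩ extendedCap re ra rs, ((dist (platform ra) x : ℝ) : EReal)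

/-- The angle `ζ(d)`. -/
noncomputable def zetaAngle (ra rs d : ℝ) : ℝ :=
  Real.arccos ((rs ^ 2 + ra ^ 2 - d ^ 2) / (2 * rs * ra))

/-- The expression
`exp (-lam ∫_0^z cos φ (1 - exp (-(mu / π) arcsin √(1 - cos² z sec² φ))) dφ)`. -/
noncomputable def voidFormula (lam mu z : ℝ) : ℝ :=
  Real.exp (-lam * ∫ φ in (0 : ℝ)..z, Real.cos φ *
    (1 - Real.exp (-(mu / Real.pi) *
      Real.arcsin √(1 - Real.cos z ^ 2 * (1 / Real.cos φ) ^ 2))))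

/-! Almost surely there are finitely many satellites, so the distance exceeds `d` exactly when the
closed cap of radius `min d |AC|` carries no satellite. Everything thus reduces to void
probabilities of caps.

Given the orbits, a cap `B` is empty with probability `exp (-∫ f dΞ)`, where `f` is the mean number
of satellites in `B` on one orbit. Averaging over the orbits is the Laplace functional of a finite
Poisson process, `E exp (-∫ f dΞ) = exp (-∫ (1 - e^{-f}) dΛ)` (`integral_exp_neg_lintegral`).

An orbit of inclination `φ` meets the cap of central angle `z` where `sin w ≥ cos z / sin φ`, an arc
of angle `2 arcsin √(1 - cos² z / sin² φ)`. The function `f` does not depend on the longitude, and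
the shift `φ ↦ π/2 - φ` with evenness turns the integral into the stated one
(`measureReal_sphericalCap_eq_zero`). -/

/-! ### Finite counting measures and Poisson masses -/

theorem IsCountingMeasure.exists_finset_sum_dirac {E : Type*} [MeasurableSpace E] {ν : Measure E}
    (hν : IsCountingMeasure ν) (hfin : ν Set.univ ≠ ⊤) :
    ∃ (t : Finset ℕ) (x : ℕ → E), ν = ∑ i ∈ t, Measure.dirac (x i) := by
  obtain ⟨s, x, rfl⟩ := hν
  have hs : s.Finite := by
    rw [Measure.sum_apply _ MeasurableSet.univ] at hfin
    simp only [measure_univ] at hfin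
    by_contra hs
    have : Infinite s := Set.infinite_coe_iff.2 hs
    exact hfin (ENNReal.tsum_const_eq_top_of_ne_zero one_ne_zero)
  refine ⟨hs.toFinset, x, ?_⟩
  have := hs.fintype
  rw [Measure.sum_fintype, ← Finset.sum_coe_sort hs.toFinset]
  exact Fintype.sum_equiv (Equiv.subtypeEquivRight fun i => by simp) _ _ fun i => rfl

theorem exists_nat_sum_dirac_apply {E : Type*} [MeasurableSpace E] (t : Finset ℕ) (x : ℕ → E)
    {B : Set E} (hB : MeasurableSet B) :
    ∃ k : ℕ, (∑ i ∈ t, Measure.dirac (x i)) B = (k : ENNReal) := by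
  classical
  refine ⟨(t.filter fun i => x i ∈ B).card, ?_⟩
  rw [Measure.finsetSum_apply, Finset.card_filter, Nat.cast_sum]
  refine Finset.sum_congr rfl fun i _ => ?_
  rw [Measure.dirac_apply' _ hB]
  by_cases h : x i ∈ B <;> simp [h]

theorem tsum_ofReal_poissonMass {r : ENNReal} (hr : r ≠ ⊤) :
    ∑' k, ENNReal.ofReal (poissonMass r k) = 1 := by
  have h := measure_iUnion (μ := poissonMeasure r.toNNReal) (f := fun k : ℕ => {k})
    (fun i j hij => by simpa using hij) (fun i => measurableSet_singleton i)
  rw [Set.iUnion_of_singleton, measure_univ] at h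
  rw [h]
  refine tsum_congr fun k => ?_
  rw [poissonMass, if_neg hr, ofReal_measureReal]

theorem poissonMass_zero (r : ENNReal) :
    poissonMass r 0 = if r = ⊤ then 0 else Real.exp (-r.toReal) := by
  unfold poissonMass
  split_ifs with h
  · rfl
  · rw [poissonMeasure_real_singleton]
    simp [ENNReal.coe_toNNReal_eq_toReal]

theorem poissonMass_nonneg (r : ENNReal) (k : ℕ) : 0 ≤ poissonMass r k := by
  unfold poissonMass
  split_ifs
  · rfl
  · exact measureReal_nonneg

theorem poissonMass_le_one (r : ENNReal) (k : ℕ) : poissonMass r k ≤ 1 := by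
  unfold poissonMass
  split_ifs
  · exact zero_le_one
  · exact measureReal_le_one

theorem measurable_poissonMass (k : ℕ) : Measurable fun r => poissonMass r k := by
  refine Measurable.ite (measurableSet_singleton _) measurable_const ?_
  simp_rw [poissonMeasure_real_singleton]
  fun_prop

theorem integral_exp_neg_mul_poissonMeasure (r : NNReal) (c : ℝ) :
    ∫ k : ℕ, Real.exp (-(c * k)) ∂(poissonMeasure r) =
      Real.exp (-(r * (1 - Real.exp (-c)))) := by
  rw [integral_poissonMeasure]
  have h := (NormedSpace.expSeries_div_hasSum_exp (r * Real.exp (-c))).mul_left (Real.exp (-r))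
  rw [← Real.exp_eq_exp_ℝ, ← Real.exp_add] at h
  rw [show -(r * (1 - Real.exp (-c))) = -(r : ℝ) + r * Real.exp (-c) by ring, ← h.tsum_eq]
  refine tsum_congr fun k => ?_
  rw [smul_eq_mul, mul_pow, ← Real.exp_nat_mul, show -(c * (k : ℝ)) = k * -c by ring]
  ring

/-! ### The Laplace functional of a finite Poisson process -/

section Poisson

variable {Ω E : Type*} [MeasurableSpace Ω] [MeasurableSpace E] {P : Measure Ω}
  [IsProbabilityMeasure P] {N : Ω → Measure E} {Λ : Measure E}

theorem ae_exists_eq_natCast {X : Ω → ENNReal} (hX : Measurable X)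
    (h : ∑' k : ℕ, P {ω | X ω = k} = 1) : ∀ᵐ ω ∂P, ∃ k : ℕ, X ω = k := by
  have hm : ∀ k : ℕ, MeasurableSet {ω | X ω = k} := fun k => hX (measurableSet_singleton _)
  have hd : Pairwise (Function.onFun Disjoint fun k : ℕ => {ω | X ω = k}) := by
    intro i j hij
    refine Set.disjoint_left.2 fun ω hi hj => hij ?_
    simp only [Set.mem_ofPred_eq] at hi hj
    exact_mod_cast hi.symm.trans hj
  rw [← measure_iUnion hd hm] at h
  have := (prob_compl_eq_zero_iff (MeasurableSet.iUnion hm)).2 h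
  filter_upwards [compl_mem_ae_iff.2 this] with ω hω
  simpa using hω

/-- The total count has a Poisson law of finite mean, whose masses on `ℕ` already sum to one, so it
is almost surely finite. -/
theorem IsPoissonPointProcess.ae_exists_finset (hN : IsPoissonPointProcess P N Λ)
    (hΛ : Λ Set.univ ≠ ⊤) :
    ∀ᵐ ω ∂P, ∃ (t : Finset ℕ) (x : ℕ → E), N ω = ∑ i ∈ t, Measure.dirac (x i) := by
  have hu : ∀ᵐ ω ∂P, ∃ k : ℕ, N ω Set.univ = k := by
    refine ae_exists_eq_natCast
      (Measure.measurable_measure.1 hN.isPointProcess.measurable _ .univ) ?_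
    rw [← tsum_ofReal_poissonMass hΛ]
    refine tsum_congr fun k => ?_
    have h := hN.counts 1 (fun _ => Set.univ) (fun _ => k) (fun _ => .univ)
      fun i j hij => (hij (Subsingleton.elim i j)).elim
    simp only [forall_const, Finset.univ_unique, Finset.prod_const, Finset.card_singleton,
      pow_one] at h
    rw [← h, ofReal_measureReal]
  filter_upwards [hu, hN.isPointProcess.counting] with ω ⟨k, hk⟩ hc
  exact hc.exists_finset_sum_dirac (by simp [hk])

/-- The count vector has a product of Poisson measures as its law, so the expectation factors into
one-dimensional Laplace transforms. -/
theorem IsPoissonPointProcess.integral_prod_exp_neg (hN : IsPoissonPointProcess P N Λ)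
    (hΛ : Λ Set.univ ≠ ⊤) {n : ℕ} (B : Fin n → Set E) (hB : ∀ i, MeasurableSet (B i))
    (hd : Pairwise fun i j => Disjoint (B i) (B j)) (c : Fin n → ℝ) :
    ∫ ω, ∏ i, Real.exp (-(c i * (N ω (B i)).toReal)) ∂P =
      ∏ i, Real.exp (-((Λ (B i)).toReal * (1 - Real.exp (-c i)))) := by
  have hΛB : ∀ i, Λ (B i) ≠ ⊤ := fun i => measure_ne_top_of_subset (Set.subset_univ _) hΛ
  have hm : ∀ i, Measurable fun ω => N ω (B i) := fun i =>
    Measure.measurable_measure.1 hN.isPointProcess.measurable _ (hB i)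
  -- A measurable `ℕ`-valued version of the counts, which are natural numbers only almost surely.
  set Y : Ω → Fin n → ℕ := fun ω i => ⌊(N ω (B i)).toReal⌋₊ with hYdef
  have hY : Measurable Y := measurable_pi_lambda _ fun i =>
    Nat.measurable_floor.comp (hm i).ennreal_toReal
  have hae : ∀ᵐ ω ∂P, ∀ i, N ω (B i) = (Y ω i : ENNReal) := by
    filter_upwards [hN.ae_exists_finset hΛ] with ω ⟨t, x, htx⟩ i
    obtain ⟨k, hk⟩ := exists_nat_sum_dirac_apply t x (hB i)
    rw [← htx] at hk
    simp [hYdef, hk]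
  have hlaw : P.map Y = Measure.pi fun i => poissonMeasure (Λ (B i)).toNNReal := by
    refine Measure.ext_of_singleton fun k => ?_
    rw [Measure.map_apply hY (measurableSet_singleton _), Measure.pi_singleton]
    have h := hN.counts n B k hB hd
    have h1 : P (Y ⁻¹' {k}) = P {ω | ∀ i, N ω (B i) = (k i : ENNReal)} := by
      refine measure_congr ?_
      filter_upwards [hae] with ω hω
      refine propext ?_
      change Y ω = k ↔ ∀ i, N ω (B i) = (k i : ENNReal)
      simp [hω, funext_iff]
    rw [h1, ← ofReal_measureReal, h, ENNReal.ofReal_prod_of_nonneg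
      fun i _ => poissonMass_nonneg _ _]
    refine Finset.prod_congr rfl fun i _ => ?_
    rw [poissonMass, if_neg (hΛB i), ofReal_measureReal]
  calc ∫ ω, ∏ i, Real.exp (-(c i * (N ω (B i)).toReal)) ∂P
      = ∫ ω, ∏ i, Real.exp (-(c i * (Y ω i : ℝ))) ∂P := by
        refine integral_congr_ae ?_
        filter_upwards [hae] with ω hω
        simp [hω]
    _ = ∫ k, ∏ i, Real.exp (-(c i * (k i : ℝ))) ∂(P.map Y) :=
        (integral_map hY.aemeasurable (f := fun k : Fin n → ℕ =>
          ∏ i, Real.exp (-(c i * (k i : ℝ)))) (Measurable.aestronglyMeasurable .of_discrete)).symm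
    _ = _ := by
        rw [hlaw, integral_fintype_prod_eq_prod (fun i (k : ℕ) => Real.exp (-(c i * (k : ℝ))))]
        refine Finset.prod_congr rfl fun i _ => ?_
        rw [integral_exp_neg_mul_poissonMeasure, ENNReal.coe_toNNReal_eq_toReal]

/-- The level sets of `g` are disjoint, so the integral of `g` is a weighted sum of independent
counts. -/
theorem IsPoissonPointProcess.integral_exp_neg_simpleFunc (hN : IsPoissonPointProcess P N Λ)
    (hΛ : Λ Set.univ ≠ ⊤) (g : SimpleFunc E ENNReal) (hg : ∀ x, g x ≠ ⊤) :
    ∫ ω, Real.exp (-(∫⁻ x, g x ∂(N ω)).toReal) ∂P =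
      Real.exp (-∫ x, (1 - Real.exp (-(g x).toReal)) ∂Λ) := by
  have : IsFiniteMeasure Λ := ⟨hΛ.lt_top⟩
  let e := g.range.equivFin
  let v : Fin g.range.card → ENNReal := fun i => (e.symm i : ENNReal)
  have hv : Function.Injective v := Subtype.val_injective.comp e.symm.injective
  have hvt : ∀ i, v i ≠ ⊤ := fun i => by
    obtain ⟨x, hx⟩ := SimpleFunc.mem_range.1 (e.symm i).2
    change (e.symm i : ENNReal) ≠ ⊤
    rw [← hx]
    exact hg x
  have hsum : ∀ {M : Type} [AddCommMonoid M] (F : ENNReal → M),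
      ∑ y ∈ g.range, F y = ∑ i, F (v i) := fun F => by
    rw [← Finset.sum_coe_sort g.range]
    exact (Equiv.sum_comp e.symm (fun y : g.range => F y)).symm
  have h := hN.integral_prod_exp_neg hΛ (fun i => g ⁻¹' {v i})
    (fun i => g.measurableSet_preimage _)
    (fun i j hij => Set.disjoint_left.2 fun x hi hj => hij (hv (by
      rw [← Set.mem_singleton_iff.1 hi, ← Set.mem_singleton_iff.1 hj])))
    (fun i => (v i).toReal)
  calc ∫ ω, Real.exp (-(∫⁻ x, g x ∂(N ω)).toReal) ∂P = _ := by
        refine integral_congr_ae ?_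
        filter_upwards [hN.ae_exists_finset hΛ] with ω ⟨t, x, htx⟩
        rw [← Real.exp_sum, Finset.sum_neg_distrib, SimpleFunc.lintegral_eq_lintegral,
          SimpleFunc.lintegral, hsum, ENNReal.toReal_sum]
        · simp
        · intro i _
          obtain ⟨k, hk⟩ := exists_nat_sum_dirac_apply t x (g.measurableSet_preimage {v i})
          rw [← htx] at hk
          rw [hk]
          exact ENNReal.mul_ne_top (hvt i) (by simp)
    _ = _ := h
    _ = _ := by
        rw [← Real.exp_sum, Finset.sum_neg_distrib]
        congr 2
        have hx : ∀ x, 1 - Real.exp (-(g x).toReal) = ∑ i, (g ⁻¹' {v i}).indicator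
            (fun _ => 1 - Real.exp (-(v i).toReal)) x := fun x => by
          rw [← hsum fun y => (g ⁻¹' {y}).indicator (fun _ => 1 - Real.exp (-y.toReal)) x,
            Finset.sum_eq_single (g x)]
          · simp
          · exact fun y _ hy => Set.indicator_of_notMem (fun h => hy h.symm) _
          · exact fun h => (h (SimpleFunc.mem_range_self g x)).elim
        simp_rw [hx]
        rw [integral_finsetSum _ fun i _ =>
          (integrable_const _).indicator (g.measurableSet_preimage _)]
        refine Finset.sum_congr rfl fun i _ => ?_
        rw [integral_indicator_const _ (g.measurableSet_preimage _), smul_eq_mul, measureReal_def]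

/-- Simple functions increasing to `f`, with dominated convergence on both sides. The bound `C`
keeps the integrals against `N ω` almost surely finite, where `toReal` is continuous. -/
theorem IsPoissonPointProcess.integral_exp_neg_lintegral (hN : IsPoissonPointProcess P N Λ)
    (hΛ : Λ Set.univ ≠ ⊤) {f : E → ENNReal} (hf : Measurable f) {C : ENNReal} (hC : C ≠ ⊤)
    (hfC : ∀ x, f x ≤ C) :
    ∫ ω, Real.exp (-(∫⁻ x, f x ∂(N ω)).toReal) ∂P =
      Real.exp (-∫ x, (1 - Real.exp (-(f x).toReal)) ∂Λ) := by
  have : IsFiniteMeasure Λ := ⟨hΛ.lt_top⟩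
  have hft : ∀ x, f x ≠ ⊤ := fun x => ((hfC x).trans_lt hC.lt_top).ne
  have hbound : ∀ r : ENNReal, ‖Real.exp (-r.toReal)‖ ≤ 1 := fun r => by
    rw [Real.norm_eq_abs, Real.abs_exp]
    exact Real.exp_le_one_iff.2 (neg_nonpos.2 ENNReal.toReal_nonneg)
  have hbound' : ∀ r : ENNReal, ‖1 - Real.exp (-r.toReal)‖ ≤ 1 := fun r => by
    rw [Real.norm_eq_abs, abs_of_nonneg]
    · linarith [Real.exp_pos (-r.toReal)]
    · exact sub_nonneg.2 (Real.exp_le_one_iff.2 (neg_nonpos.2 ENNReal.toReal_nonneg))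
  have hmeas : ∀ g : E → ENNReal, Measurable g → Measurable fun ω => ∫⁻ x, g x ∂(N ω) :=
    fun g hg => (Measure.measurable_lintegral hg).comp hN.isPointProcess.measurable
  let g := SimpleFunc.eapprox f
  have hL : Filter.Tendsto (fun n => ∫ ω, Real.exp (-(∫⁻ x, g n x ∂(N ω)).toReal) ∂P)
      Filter.atTop (nhds (∫ ω, Real.exp (-(∫⁻ x, f x ∂(N ω)).toReal) ∂P)) := by
    refine tendsto_integral_of_dominated_convergence (fun _ => 1) (fun n => ?_)
      (integrable_const _) (fun n => .of_forall fun ω => hbound _) ?_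
    · exact (Real.measurable_exp.comp
        (hmeas _ (g n).measurable).ennreal_toReal.neg).aestronglyMeasurable
    · filter_upwards [hN.ae_exists_finset hΛ] with ω ⟨t, x, htx⟩
      have hfin : ∫⁻ x, f x ∂(N ω) ≠ ⊤ := by
        refine ((lintegral_mono hfC).trans_lt ?_).ne
        obtain ⟨k, hk⟩ := exists_nat_sum_dirac_apply t x MeasurableSet.univ
        rw [lintegral_const, htx, hk]
        exact ENNReal.mul_lt_top hC.lt_top (by simp)
      refine (Real.continuous_exp.tendsto _).comp (Filter.Tendsto.neg ?_)
      refine (ENNReal.tendsto_toReal hfin).comp ?_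
      exact lintegral_tendsto_of_tendsto_of_monotone (fun n => (g n).measurable.aemeasurable)
        (.of_forall fun x _ _ hij => SimpleFunc.monotone_eapprox f hij x)
        (.of_forall fun x => SimpleFunc.tendsto_eapprox hf x)
  have hR : Filter.Tendsto (fun n => Real.exp (-∫ x, (1 - Real.exp (-(g n x).toReal)) ∂Λ))
      Filter.atTop (nhds (Real.exp (-∫ x, (1 - Real.exp (-(f x).toReal)) ∂Λ))) := by
    refine (Real.continuous_exp.tendsto _).comp (Filter.Tendsto.neg ?_)
    refine tendsto_integral_of_dominated_convergence (fun _ => 1) (fun n => ?_)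
      (integrable_const _) (fun n => .of_forall fun x => hbound' _) (.of_forall fun x => ?_)
    · exact (measurable_const.sub (Real.measurable_exp.comp
        (g n).measurable.ennreal_toReal.neg)).aestronglyMeasurable
    · refine Filter.Tendsto.const_sub _ ((Real.continuous_exp.tendsto _).comp
        (Filter.Tendsto.neg ((ENNReal.tendsto_toReal (hft x)).comp ?_)))
      exact SimpleFunc.tendsto_eapprox hf x
  refine tendsto_nhds_unique hL (hR.congr fun n => ?_)
  exact (hN.integral_exp_neg_simpleFunc hΛ (g n) fun x => (SimpleFunc.eapprox_lt_top f n x).ne).symm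

end Poisson

/-! ### Counts of a Cox process -/

section Cox

variable {Ω E F : Type*} [MeasurableSpace Ω] [MeasurableSpace E] [MeasurableSpace F]
  {P : Measure Ω} [IsProbabilityMeasure P] {Ξ : Ω → Measure F} {N : Ω → Measure E}
  {Λ : Measure F → Measure E}

theorem IsCoxPointProcess.measureReal_apply_eq (hΞ : Measurable Ξ)
    (hN : IsCoxPointProcess P Ξ N Λ) {B : Set E} (hB : MeasurableSet B) (k : ℕ) :
    P.real {ω | N ω B = k} = ∫ ω, poissonMass (Λ (Ξ ω) B) k ∂P := by
  have h := hN.counts 1 (fun _ => B) (fun _ => k) (fun _ => hB)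
    fun i j hij => (hij (Subsingleton.elim i j)).elim
  simp only [forall_const, Finset.univ_unique, Finset.prod_const, Finset.card_singleton,
    pow_one] at h
  rw [← integral_congr_ae h, integral_condExp hΞ.comap_le, integral_indicator_const]
  · simp
  · exact Measure.measurable_measure.1 hN.isPointProcess.measurable _ hB (measurableSet_singleton _)

/-- The total count is a mixture of Poisson laws of almost surely finite mean; summing its masses
under the expectation gives one. -/
theorem IsCoxPointProcess.ae_exists_finset (hΞ : Measurable Ξ)
    (hN : IsCoxPointProcess P Ξ N Λ) (hΛm : Measurable fun ω => Λ (Ξ ω) Set.univ)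
    (hΛ : ∀ᵐ ω ∂P, Λ (Ξ ω) Set.univ ≠ ⊤) :
    ∀ᵐ ω ∂P, ∃ (t : Finset ℕ) (x : ℕ → E), N ω = ∑ i ∈ t, Measure.dirac (x i) := by
  have hu : ∀ᵐ ω ∂P, ∃ k : ℕ, N ω Set.univ = k := by
    refine ae_exists_eq_natCast
      (Measure.measurable_measure.1 hN.isPointProcess.measurable _ .univ) ?_
    have hm : ∀ k, Measurable fun ω => poissonMass (Λ (Ξ ω) Set.univ) k := fun k =>
      (measurable_poissonMass k).comp hΛm
    have h : ∀ k : ℕ, P {ω | N ω Set.univ = k} =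
        ∫⁻ ω, ENNReal.ofReal (poissonMass (Λ (Ξ ω) Set.univ) k) ∂P := fun k => by
      rw [← ofReal_measureReal, hN.measureReal_apply_eq hΞ .univ,
        ofReal_integral_eq_lintegral_ofReal]
      · refine Integrable.of_bound (hm k).aestronglyMeasurable 1 (.of_forall fun ω => ?_)
        rw [Real.norm_eq_abs, abs_of_nonneg (poissonMass_nonneg _ _)]
        exact poissonMass_le_one _ _
      · exact .of_forall fun ω => poissonMass_nonneg _ _
    simp_rw [h]
    rw [← lintegral_tsum fun k => (hm k).ennreal_ofReal.aemeasurable]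
    rw [lintegral_congr_ae (g := fun _ => 1)]
    · simp
    · filter_upwards [hΛ] with ω hω using tsum_ofReal_poissonMass hω
  filter_upwards [hu, hN.isPointProcess.counting] with ω ⟨k, hk⟩ hc
  exact hc.exists_finset_sum_dirac (by simp [hk])

end Cox

/-! ### The arc cut from an orbit by a cap -/

theorem setOf_le_sin_inter_Ico {c : ℝ} (h0 : 0 ≤ c) (h1 : c ≤ 1) :
    {w | c ≤ Real.sin w} ∩ Set.Ico 0 (2 * Real.pi) =
      Set.Icc (Real.arcsin c) (Real.pi - Real.arcsin c) := by
  have hpi := Real.pi_pos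
  have ha : 0 ≤ Real.arcsin c := Real.arcsin_nonneg.2 h0
  have ha' : Real.arcsin c ≤ Real.pi / 2 := Real.arcsin_le_pi_div_two c
  have hsin : Real.sin (Real.arcsin c) = c := Real.sin_arcsin (by linarith) h1
  have key : ∀ w, 0 ≤ w → w ≤ Real.pi / 2 → (c ≤ Real.sin w ↔ Real.arcsin c ≤ w) := by
    intro w hw hw'
    rw [Real.arcsin_le_iff_le_sin ⟨by linarith, h1⟩ ⟨by linarith, hw'⟩]
  ext w
  simp only [Set.mem_inter_iff, Set.mem_ofPred_eq, Set.mem_Ico, Set.mem_Icc]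
  constructor
  · rintro ⟨hc, hw0, hw1⟩
    rcases le_or_gt w (Real.pi / 2) with hw | hw
    · exact ⟨(key w hw0 hw).1 hc, by linarith⟩
    rcases le_or_gt w Real.pi with hw' | hw'
    · rw [← Real.sin_pi_sub] at hc
      have := (key (Real.pi - w) (by linarith) (by linarith)).1 hc
      exact ⟨by linarith, by linarith⟩
    · have : 0 < Real.sin (w - Real.pi) :=
        Real.sin_pos_of_pos_of_lt_pi (by linarith) (by linarith)
      rw [Real.sin_sub_pi] at this
      linarith
  · rintro ⟨hw0, hw1⟩
    refine ⟨?_, by linarith, by linarith⟩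
    rcases le_or_gt w (Real.pi / 2) with hw | hw
    · exact (key w (by linarith) hw).2 hw0
    · rw [← Real.sin_pi_sub]
      exact (key _ (by linarith) (by linarith)).2 (by linarith)

theorem volume_setOf_le_sin {c : ℝ} (h0 : 0 ≤ c) :
    volume ({w | c ≤ Real.sin w} ∩ Set.Ico 0 (2 * Real.pi)) =
      ENNReal.ofReal (2 * Real.arcsin √(1 - c ^ 2)) := by
  rcases le_or_gt c 1 with h1 | h1
  · rw [setOf_le_sin_inter_Ico h0 h1, Real.volume_Icc, ← Real.arccos_eq_arcsin h0, Real.arccos]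
    congr 1
    ring
  -- The formula survives for `c > 1` because `√` of a negative number is `0`.
  · have : {w | c ≤ Real.sin w} = ∅ := Set.eq_empty_of_forall_notMem fun w hw =>
      absurd (Real.sin_le_one w) (not_le.2 (h1.trans_le hw))
    rw [this, Real.sqrt_eq_zero_of_nonpos (by nlinarith)]
    simp

theorem norm_orbitPoint {rs : ℝ} (hrs : 0 ≤ rs) (p : ℝ × ℝ) (w : ℝ) :
    ‖orbitPoint rs p w‖ = rs := by
  rw [← sq_eq_sq₀ (norm_nonneg _) hrs, EuclideanSpace.norm_sq_eq, Fin.sum_univ_three]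
  simp only [orbitPoint, Real.norm_eq_abs, sq_abs]
  simp
  linear_combination (rs ^ 2 * (Real.cos w ^ 2 + Real.sin w ^ 2 * Real.cos p.2 ^ 2)) *
    Real.sin_sq_add_cos_sq p.1 + rs ^ 2 * Real.sin w ^ 2 * Real.sin_sq_add_cos_sq p.2 +
    rs ^ 2 * Real.sin_sq_add_cos_sq w

theorem dist_orbitPoint_platform_sq (rs ra : ℝ) (p : ℝ × ℝ) (w : ℝ) :
    dist (orbitPoint rs p w) (platform ra) ^ 2 =
      rs ^ 2 + ra ^ 2 - 2 * rs * ra * (Real.sin w * Real.sin p.2) := by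
  rw [dist_eq_norm, EuclideanSpace.norm_sq_eq, Fin.sum_univ_three]
  simp only [orbitPoint, platform, Real.norm_eq_abs, sq_abs]
  simp
  linear_combination (rs ^ 2 * (Real.cos w ^ 2 + Real.sin w ^ 2 * Real.cos p.2 ^ 2)) *
    Real.sin_sq_add_cos_sq p.1 + rs ^ 2 * Real.sin w ^ 2 * Real.sin_sq_add_cos_sq p.2 +
    rs ^ 2 * Real.sin_sq_add_cos_sq w

/-- The squared distance to the platform is affine in the height `rs * sin w * sin φ`, so membership
is a lower bound on `sin w`. -/
theorem orbitPoint_mem_sphericalCap_iff {rs ra d : ℝ} (hrs : 0 < rs) (hra : 0 < ra) (hd : 0 ≤ d)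
    {p : ℝ × ℝ} (hp : 0 < Real.sin p.2) (w : ℝ) :
    orbitPoint rs p w ∈ sphericalCap rs (platform ra) d ↔
      (rs ^ 2 + ra ^ 2 - d ^ 2) / (2 * rs * ra) / Real.sin p.2 ≤ Real.sin w := by
  have h2 : 0 < 2 * rs * ra := by positivity
  rw [div_le_iff₀ hp, div_le_iff₀ h2]
  change ‖orbitPoint rs p w‖ = rs ∧ _ ↔ _
  rw [← sq_le_sq₀ dist_nonneg hd, dist_orbitPoint_platform_sq]
  simp only [norm_orbitPoint hrs.le, true_and]
  constructor <;> intro h <;> linarith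

theorem measurableSet_sphericalCap (rs : ℝ) (X : Space) (d : ℝ) :
    MeasurableSet (sphericalCap rs X d) :=
  ((isClosed_eq continuous_norm continuous_const).inter
    (isClosed_le (continuous_id.dist continuous_const) continuous_const)).measurableSet

theorem measurable_orbitPoint_apply (rs : ℝ) (p : ℝ × ℝ) : Measurable (orbitPoint rs p) :=
  have key : ∀ f : ℝ × ℝ → ℝ → Space, (Measurable fun q : (ℝ × ℝ) × ℝ => f q.1 q.2) →
      Measurable (f p) := fun _ hf => hf.comp measurable_prodMk_left
  key _ (measurable_orbitPoint rs)

theorem orbitArcLength_apply (rs : ℝ) (p : ℝ × ℝ) {B : Set Space} (hB : MeasurableSet B) :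
    orbitArcLength rs p B =
      ENNReal.ofReal rs * volume (orbitPoint rs p ⁻¹' B ∩ Set.Ico 0 (2 * Real.pi)) := by
  change (ENNReal.ofReal rs •
    (volume.restrict (Set.Ico 0 (2 * Real.pi))).map (orbitPoint rs p)) B = _
  rw [Measure.smul_apply, Measure.map_apply (measurable_orbitPoint_apply rs p) hB,
    Measure.restrict_apply (measurable_orbitPoint_apply rs p hB), smul_eq_mul]

theorem orbitArcLength_le (rs : ℝ) (p : ℝ × ℝ) {B : Set Space} (hB : MeasurableSet B) :
    orbitArcLength rs p B ≤ ENNReal.ofReal rs * ENNReal.ofReal (2 * Real.pi) := by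
  rw [orbitArcLength_apply rs p hB]
  refine mul_le_mul_right ((measure_mono Set.inter_subset_right).trans ?_) _
  simp

theorem satelliteIntensity_apply (mu rs : ℝ) (ξ : Measure (ℝ × ℝ)) {B : Set Space}
    (hB : MeasurableSet B) :
    satelliteIntensity mu rs ξ B =
      ∫⁻ p, ENNReal.ofReal (mu / (2 * Real.pi * rs)) * orbitArcLength rs p B ∂ξ := by
  rw [satelliteIntensity, Measure.smul_apply,
    Measure.bind_apply hB (orbitArcLength rs).measurable.aemeasurable, smul_eq_mul,
    lintegral_const_mul _ ((orbitArcLength rs).measurable_coe hB)]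

theorem toReal_orbitArcLength_sphericalCap {rs ra d mu : ℝ} (hrs : 0 < rs) (hra : 0 < ra)
    (hd : 0 ≤ d) (hmu : 0 ≤ mu) (hc : 0 ≤ (rs ^ 2 + ra ^ 2 - d ^ 2) / (2 * rs * ra))
    {p : ℝ × ℝ} (hp : 0 < Real.sin p.2) :
    (ENNReal.ofReal (mu / (2 * Real.pi * rs)) *
        orbitArcLength rs p (sphericalCap rs (platform ra) d)).toReal =
      mu / Real.pi * Real.arcsin
        √(1 - ((rs ^ 2 + ra ^ 2 - d ^ 2) / (2 * rs * ra) / Real.sin p.2) ^ 2) := by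
  have hpi := Real.pi_pos
  have hset : orbitPoint rs p ⁻¹' sphericalCap rs (platform ra) d =
      {w | (rs ^ 2 + ra ^ 2 - d ^ 2) / (2 * rs * ra) / Real.sin p.2 ≤ Real.sin w} := by
    ext w
    exact orbitPoint_mem_sphericalCap_iff hrs hra hd hp w
  rw [orbitArcLength_apply rs p (measurableSet_sphericalCap _ _ _), hset,
    volume_setOf_le_sin (div_nonneg hc hp.le), ENNReal.toReal_mul, ENNReal.toReal_mul,
    ENNReal.toReal_ofReal (by positivity), ENNReal.toReal_ofReal hrs.le, ENNReal.toReal_ofReal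
      (mul_nonneg zero_le_two (Real.arcsin_nonneg.2 (Real.sqrt_nonneg _)))]
  field_simp

/-! ### Integration against the orbit intensity -/

theorem orbitIntensity_univ_ne_top (lam : ℝ) : orbitIntensity lam Set.univ ≠ ⊤ := by
  rw [orbitIntensity, withDensity_apply _ .univ, Measure.restrict_univ]
  have hb : ∀ p : ℝ × ℝ, ENNReal.ofReal (lam * Real.sin p.2 / (2 * Real.pi)) ≤
      ENNReal.ofReal (|lam| / (2 * Real.pi)) := fun p => by
    refine ENNReal.ofReal_le_ofReal ?_
    have : lam * Real.sin p.2 ≤ |lam| := (le_abs_self _).trans (by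
      rw [abs_mul]
      exact mul_le_of_le_one_right (abs_nonneg _) (Real.abs_sin_le_one _))
    gcongr
  refine ((lintegral_mono hb).trans_lt ?_).ne
  rw [lintegral_const, Measure.restrict_apply .univ, Set.univ_inter, Measure.volume_eq_prod,
    Measure.prod_prod]
  refine ENNReal.mul_lt_top ENNReal.ofReal_lt_top (ENNReal.mul_lt_top ?_ ?_) <;> simp

/-- The longitude integrates out to a factor `π`. Agreement is needed only where `sin φ > 0`, since
the density vanishes at inclination `0`. -/
theorem integral_orbitIntensity {lam : ℝ} (hlam : 0 ≤ lam) {F : ℝ × ℝ → ℝ} {G : ℝ → ℝ}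
    (h : ∀ p : ℝ × ℝ, 0 < Real.sin p.2 → F p = G p.2) :
    ∫ p, F p ∂(orbitIntensity lam) =
      lam / 2 * ∫ φ in (0 : ℝ)..Real.pi, Real.sin φ * G φ := by
  have hpi := Real.pi_pos
  rw [orbitIntensity, integral_withDensity_eq_integral_toReal_smul (by fun_prop)
    (.of_forall fun _ => ENNReal.ofReal_lt_top)]
  have hcongr : ∀ p ∈ Set.Ico 0 Real.pi ×ˢ Set.Ico 0 Real.pi,
      (ENNReal.ofReal (lam * Real.sin p.2 / (2 * Real.pi))).toReal • F p =
        (fun φ => lam / (2 * Real.pi) * (Real.sin φ * G φ)) p.2 := by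
    rintro p ⟨-, hp⟩
    have hs : 0 ≤ Real.sin p.2 := Real.sin_nonneg_of_nonneg_of_le_pi hp.1 hp.2.le
    rw [ENNReal.toReal_ofReal (by positivity), smul_eq_mul]
    rcases hs.eq_or_lt with hs | hs
    · simp [← hs]
    · simp only [h p hs]
      ring
  rw [setIntegral_congr_fun (measurableSet_Ico.prod measurableSet_Ico) hcongr,
    Measure.volume_eq_prod, ← Measure.prod_restrict,
    integral_fun_snd (μ := volume.restrict (Set.Ico 0 Real.pi))
      (fun φ => lam / (2 * Real.pi) * (Real.sin φ * G φ)), integral_const_mul,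
    integral_Ico_eq_integral_Ioc, ← intervalIntegral.integral_of_le hpi.le, measureReal_def,
    Measure.restrict_apply .univ, Set.univ_inter, Real.volume_Ico,
    ENNReal.toReal_ofReal (by linarith), smul_eq_mul]
  field_simp
  ring

/-- The reflection `φ ↦ π/2 - φ` yields an even integrand on `[-π/2, π/2]`, which vanishes on `(z,
π/2]` by `hG`. -/
theorem integral_sin_mul_eq_two_mul_integral_cos_mul {G : ℝ → ℝ} {z : ℝ} (hz0 : 0 ≤ z)
    (hz1 : z ≤ Real.pi / 2)
    (hint : IntervalIntegrable (fun φ => Real.cos φ * G (Real.cos φ)) volume 0 (Real.pi / 2))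
    (hG : ∀ c, 0 < c → c < Real.cos z → G c = 0) :
    ∫ φ in (0 : ℝ)..Real.pi, Real.sin φ * G (Real.sin φ) =
      2 * ∫ φ in (0 : ℝ)..z, Real.cos φ * G (Real.cos φ) := by
  have hpi := Real.pi_pos
  set h : ℝ → ℝ := fun φ => Real.cos φ * G (Real.cos φ) with hh
  have hneg : ∀ φ, h (-φ) = h φ := fun φ => by simp [hh]
  have hint' : IntervalIntegrable h volume (-(Real.pi / 2)) 0 := by
    have := (IntervalIntegrable.iff_comp_neg (f := h) (a := 0) (b := Real.pi / 2)).1 hint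
    simp only [hneg, neg_zero] at this
    exact this.symm
  have h1 : ∫ φ in (0 : ℝ)..Real.pi, Real.sin φ * G (Real.sin φ) =
      ∫ φ in (-(Real.pi / 2))..(Real.pi / 2), h φ := by
    have := intervalIntegral.integral_comp_sub_left (a := 0) (b := Real.pi) h (Real.pi / 2)
    simp only [hh, Real.cos_pi_div_two_sub] at this
    rw [this]
    congr 1 <;> ring
  have h2 : ∫ φ in (-(Real.pi / 2))..0, h φ = ∫ φ in (0 : ℝ)..(Real.pi / 2), h φ := by
    have := intervalIntegral.integral_comp_neg (a := 0) (b := Real.pi / 2) h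
    simp only [hneg, neg_zero] at this
    exact this.symm
  have h3 : ∫ φ in z..(Real.pi / 2), h φ = 0 := by
    refine intervalIntegral.integral_zero_ae (.of_forall fun φ hφ => ?_)
    rw [Set.uIoc_of_le hz1] at hφ
    rcases hφ.2.eq_or_lt with hφ' | hφ'
    -- At `φ = π/2` the factor `cos φ` vanishes; `hG` says nothing about `G 0`.
    · simp [hh, hφ']
    · rw [hh]
      simp only
      rw [hG _ (Real.cos_pos_of_mem_Ioo ⟨by linarith [hφ.1], hφ'⟩)
        (Real.cos_lt_cos_of_nonneg_of_le_pi_div_two hz0 hφ'.le hφ.1), mul_zero]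
  have hsub1 : IntervalIntegrable h volume 0 z := hint.mono_set (by
    rw [Set.uIcc_of_le hz0, Set.uIcc_of_le (by linarith)]
    exact Set.Icc_subset_Icc_right hz1)
  have hsub2 : IntervalIntegrable h volume z (Real.pi / 2) := hint.mono_set (by
    rw [Set.uIcc_of_le hz1, Set.uIcc_of_le (by linarith)]
    exact Set.Icc_subset_Icc_left hz0)
  rw [h1, ← intervalIntegral.integral_add_adjacent_intervals hint' hint, h2,
    ← intervalIntegral.integral_add_adjacent_intervals hsub1 hsub2, h3]
  ring

/-! ### Void probabilities of the satellite network -/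

theorem IsSatelliteNetwork.measurable_satelliteIntensity_apply {Ω : Type*} [MeasurableSpace Ω]
    {P : Measure Ω} {lam mu rs : ℝ} {Ξ : Ω → Measure (ℝ × ℝ)} {Ψ : Ω → Measure Space}
    (hnet : IsSatelliteNetwork P lam mu rs Ξ Ψ) {B : Set Space} (hB : MeasurableSet B) :
    Measurable fun ω => satelliteIntensity mu rs (Ξ ω) B := by
  simp_rw [satelliteIntensity_apply mu rs _ hB]
  exact (Measure.measurable_lintegral
    (((orbitArcLength rs).measurable_coe hB).const_mul _)).comp
    hnet.orbits.isPointProcess.measurable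

section Network

variable {Ω : Type*} [MeasurableSpace Ω] {P : Measure Ω} [IsProbabilityMeasure P]
  {lam mu rs : ℝ} {Ξ : Ω → Measure (ℝ × ℝ)} {Ψ : Ω → Measure Space}

theorem IsSatelliteNetwork.ae_satelliteIntensity_ne_top
    (hnet : IsSatelliteNetwork P lam mu rs Ξ Ψ) {B : Set Space} (hB : MeasurableSet B) :
    ∀ᵐ ω ∂P, satelliteIntensity mu rs (Ξ ω) B ≠ ⊤ := by
  filter_upwards [hnet.orbits.ae_exists_finset (orbitIntensity_univ_ne_top lam)]
    with ω ⟨t, x, htx⟩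
  rw [satelliteIntensity_apply mu rs _ hB]
  refine ((lintegral_mono fun p => mul_le_mul_right (orbitArcLength_le rs p hB) _).trans_lt ?_).ne
  obtain ⟨k, hk⟩ := exists_nat_sum_dirac_apply t x MeasurableSet.univ
  rw [lintegral_const, htx, hk]
  exact ENNReal.mul_lt_top (ENNReal.mul_lt_top ENNReal.ofReal_lt_top
    (ENNReal.mul_lt_top ENNReal.ofReal_lt_top ENNReal.ofReal_lt_top)) (by simp)

theorem IsSatelliteNetwork.ae_exists_finset (hnet : IsSatelliteNetwork P lam mu rs Ξ Ψ) :
    ∀ᵐ ω ∂P, ∃ (t : Finset ℕ) (x : ℕ → Space), Ψ ω = ∑ i ∈ t, Measure.dirac (x i) :=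
  hnet.satellites.ae_exists_finset hnet.orbits.isPointProcess.measurable
    (hnet.measurable_satelliteIntensity_apply .univ) (hnet.ae_satelliteIntensity_ne_top .univ)

theorem IsSatelliteNetwork.measureReal_apply_eq_zero (hnet : IsSatelliteNetwork P lam mu rs Ξ Ψ)
    {B : Set Space} (hB : MeasurableSet B) :
    P.real {ω | Ψ ω B = 0} = Real.exp (-∫ p, (1 - Real.exp
      (-(ENNReal.ofReal (mu / (2 * Real.pi * rs)) * orbitArcLength rs p B).toReal))
        ∂(orbitIntensity lam)) := by
  have h := hnet.satellites.measureReal_apply_eq hnet.orbits.isPointProcess.measurable hB 0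
  rw [Nat.cast_zero] at h
  rw [h, ← hnet.orbits.integral_exp_neg_lintegral (orbitIntensity_univ_ne_top lam)
    (((orbitArcLength rs).measurable_coe hB).const_mul _) (ENNReal.mul_ne_top ENNReal.ofReal_ne_top
      (ENNReal.mul_ne_top ENNReal.ofReal_ne_top ENNReal.ofReal_ne_top))
    fun p => mul_le_mul_right (orbitArcLength_le rs p hB) _]
  refine integral_congr_ae ?_
  filter_upwards [hnet.ae_satelliteIntensity_ne_top hB] with ω hω
  rw [poissonMass_zero, if_neg hω, satelliteIntensity_apply mu rs _ hB]

theorem IsSatelliteNetwork.measureReal_sphericalCap_eq_zero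
    (hnet : IsSatelliteNetwork P lam mu rs Ξ Ψ) (hlam : 0 ≤ lam) (hmu : 0 ≤ mu) (hrs : 0 < rs)
    {ra d z : ℝ} (hra : 0 < ra) (hd : 0 ≤ d) (hz0 : 0 ≤ z) (hz1 : z ≤ Real.pi / 2)
    (hz : (rs ^ 2 + ra ^ 2 - d ^ 2) / (2 * rs * ra) = Real.cos z) :
    P.real {ω | Ψ ω (sphericalCap rs (platform ra) d) = 0} = voidFormula lam mu z := by
  have hpi := Real.pi_pos
  have hcz : 0 ≤ Real.cos z := Real.cos_nonneg_of_mem_Icc ⟨by linarith, hz1⟩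
  set G : ℝ → ℝ := fun c => 1 - Real.exp (-(mu / Real.pi) *
      Real.arcsin √(1 - Real.cos z ^ 2 * (1 / c) ^ 2)) with hG
  have hGbd : ∀ c, ‖G c‖ ≤ 1 := fun c => by
    have h0 : -(mu / Real.pi) * Real.arcsin √(1 - Real.cos z ^ 2 * (1 / c) ^ 2) ≤ 0 := by
      rw [neg_mul]
      exact neg_nonpos.2 (mul_nonneg (by positivity) (Real.arcsin_nonneg.2 (Real.sqrt_nonneg _)))
    have h1 := Real.exp_le_one_iff.2 h0
    rw [Real.norm_eq_abs, hG, abs_of_nonneg (by simpa using h1)]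
    simp only
    linarith [Real.exp_pos (-(mu / Real.pi) *
      Real.arcsin √(1 - Real.cos z ^ 2 * (1 / c) ^ 2))]
  have hint : IntervalIntegrable (fun φ => Real.cos φ * G (Real.cos φ)) volume 0
      (Real.pi / 2) := by
    have : Measurable fun φ => Real.cos φ * G (Real.cos φ) := by
      simp only [hG]
      have := Real.continuous_arcsin.measurable
      fun_prop
    refine (intervalIntegrable_const (c := (1 : ℝ))).mono_fun this.aestronglyMeasurable
      (.of_forall fun φ => ?_)
    simp only [norm_mul, norm_one]
    exact mul_le_one₀ (Real.abs_cos_le_one φ) (norm_nonneg _) (hGbd _)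
  rw [hnet.measureReal_apply_eq_zero (measurableSet_sphericalCap _ _ _),
    integral_orbitIntensity (G := fun φ => G (Real.sin φ)) hlam fun p hp => by
      rw [toReal_orbitArcLength_sphericalCap hrs hra hd hmu (hz ▸ hcz) hp, hz, hG]
      simp only [neg_mul, div_eq_mul_inv, mul_pow, one_mul],
    integral_sin_mul_eq_two_mul_integral_cos_mul hz0 hz1 hint fun c hc0 hc => by
      -- Orbits with `sin φ < cos z` miss the cap: the radicand is nonpositive, so the mean count is
      -- `0`.
      have : (1 : ℝ) ≤ Real.cos z ^ 2 * (1 / c) ^ 2 := by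
        rw [← mul_pow, mul_one_div]
        exact one_le_pow₀ ((one_le_div hc0).2 hc.le)
      rw [hG]
      simp only
      rw [Real.sqrt_eq_zero_of_nonpos (by linarith)]
      simp]
  rw [voidFormula]
  congr 1
  ring

end Network

/-! ### The nearest distance and the main theorem -/

/-- With finitely many atoms the infimum is a finite one, so it exceeds `d` strictly as soon as
every atom in the extended cap does. -/
theorem coe_lt_nearestDist_iff {re ra rs : ℝ} (t : Finset ℕ) (x : ℕ → Space) (d : ℝ) :
    (d : EReal) < nearestDist re ra rs (∑ i ∈ t, Measure.dirac (x i)) ↔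
      (∑ i ∈ t, Measure.dirac (x i) : Measure Space)
        (sphericalCap rs (platform ra) (min d (capRadius re ra rs))) = 0 := by
  classical
  have hne : ∀ B : Set Space, MeasurableSet B →
      ((∑ i ∈ t, Measure.dirac (x i) : Measure Space) B ≠ 0 ↔ ∃ i ∈ t, x i ∈ B) := by
    intro B hB
    rw [Measure.finsetSum_apply, Ne, Finset.sum_eq_zero_iff]
    simp [Measure.dirac_apply' _ hB]
  set S := {y | (∑ i ∈ t, Measure.dirac (x i) : Measure Space) {y} ≠ 0} ∩ extendedCap re ra rs
    with hS
  have hmem : ∀ y, y ∈ S ↔ (∃ i ∈ t, x i = y) ∧ y ∈ extendedCap re ra rs := fun y => by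
    rw [hS, Set.mem_inter_iff, Set.mem_ofPred_eq, hne _ (measurableSet_singleton y)]
    rfl
  have hfin : S.Finite := (t.image x).finite_toSet.subset fun y hy => by
    simpa using ((hmem y).1 hy).1
  have hinf : nearestDist re ra rs (∑ i ∈ t, Measure.dirac (x i)) =
      hfin.toFinset.inf fun y => ((dist (platform ra) y : ℝ) : EReal) := by
    rw [Finset.inf_eq_iInf]
    simp [nearestDist, hS]
  rw [hinf, Finset.lt_inf_iff (EReal.coe_lt_top d), ← not_iff_not, ← Ne,
    hne _ (measurableSet_sphericalCap _ _ _)]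
  simp only [Set.Finite.mem_toFinset, hmem, EReal.coe_lt_coe_iff, not_forall, not_lt]
  constructor
  · rintro ⟨y, ⟨⟨i, hi, rfl⟩, hy⟩, hd⟩
    exact ⟨i, hi, hy.1, le_min (by rwa [dist_comm]) hy.2⟩
  · rintro ⟨i, hi, hy, hd⟩
    exact ⟨x i, ⟨⟨i, hi, rfl⟩, hy, hd.trans (min_le_right _ _)⟩, by
      rw [dist_comm]
      exact hd.trans (min_le_left _ _)⟩

section Network

variable {Ω : Type*} [MeasurableSpace Ω] {P : Measure Ω} [IsProbabilityMeasure P]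
  {lam mu rs : ℝ} {Ξ : Ω → Measure (ℝ × ℝ)} {Ψ : Ω → Measure Space}

theorem IsSatelliteNetwork.ae_coe_lt_nearestDist_iff (hnet : IsSatelliteNetwork P lam mu rs Ξ Ψ)
    (re ra : ℝ) : ∀ᵐ ω ∂P, ∀ d : ℝ, (d : EReal) < nearestDist re ra rs (Ψ ω) ↔
      Ψ ω (sphericalCap rs (platform ra) (min d (capRadius re ra rs))) = 0 := by
  filter_upwards [hnet.ae_exists_finset] with ω ⟨t, x, htx⟩ d
  rw [htx]
  exact coe_lt_nearestDist_iff t x d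

theorem IsSatelliteNetwork.aemeasurable_nearestDist (hnet : IsSatelliteNetwork P lam mu rs Ξ Ψ)
    (re ra : ℝ) : AEMeasurable (fun ω => nearestDist re ra rs (Ψ ω)) P := by
  classical
  let C : ℚ → Set Space := fun q => sphericalCap rs (platform ra) (min q (capRadius re ra rs))
  -- A countable supremum of measurable functions: almost surely it runs over the rationals below
  -- the distance, hence equals it.
  refine ⟨fun ω => ⨆ q : ℚ, if Ψ ω (C q) = 0 then ((q : ℝ) : EReal) else ⊥, ?_, ?_⟩
  · refine Measurable.iSup fun q => Measurable.ite ?_ measurable_const measurable_const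
    exact Measure.measurable_measure.1 hnet.satellites.isPointProcess.measurable _
      (measurableSet_sphericalCap _ _ _) (measurableSet_singleton _)
  · filter_upwards [hnet.ae_coe_lt_nearestDist_iff re ra] with ω hω
    have hq : ∀ q : ℚ, Ψ ω (C q) = 0 ↔ ((q : ℝ) : EReal) < nearestDist re ra rs (Ψ ω) :=
      fun q => (hω q).symm
    simp only [hq]
    refine le_antisymm (le_of_forall_lt fun c hc => ?_) (iSup_le fun q => ?_)
    · obtain ⟨q, hcq, hqD⟩ := EReal.exists_rat_btwn_of_lt hc
      refine hcq.trans_le (le_iSup_of_le q ?_)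
      rw [if_pos hqD]
    · split_ifs with h
      · exact h.le
      · exact bot_le

theorem IsSatelliteNetwork.measureReal_coe_lt_nearestDist
    (hnet : IsSatelliteNetwork P lam mu rs Ξ Ψ) (re ra d : ℝ) :
    P.real {ω | (d : EReal) < nearestDist re ra rs (Ψ ω)} =
      P.real {ω | Ψ ω (sphericalCap rs (platform ra) (min d (capRadius re ra rs))) = 0} := by
  refine measureReal_congr ?_
  filter_upwards [hnet.ae_coe_lt_nearestDist_iff re ra] with ω hω
  exact propext (hω d)

end Network

theorem voidFormula_zero (lam mu : ℝ) : voidFormula lam mu 0 = 1 := by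
  simp [voidFormula]

theorem theorem3 {Ω : Type*} [MeasurableSpace Ω] (P : Measure Ω) [IsProbabilityMeasure P]
    (re ra rs lam mu : ℝ) (hre : 0 < re) (hra : re < ra) (hrs : ra < rs)
    (hangle : capAngle re ra rs ≤ Real.pi / 2) (hlam : 0 ≤ lam) (hmu : 0 ≤ mu)
    (Ξ : Ω → Measure (ℝ × ℝ)) (Ψ : Ω → Measure Space)
    (hnet : IsSatelliteNetwork P lam mu rs Ξ Ψ) :
    AEMeasurable (fun ω => nearestDist re ra rs (Ψ ω)) P ∧
    ∀ d : ℝ,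
      (d ≤ rs - ra → P.real {ω | (d : EReal) < nearestDist re ra rs (Ψ ω)} = 1) ∧
      (rs - ra < d → d ≤ capRadius re ra rs →
        P.real {ω | (d : EReal) < nearestDist re ra rs (Ψ ω)} =
          voidFormula lam mu (zetaAngle ra rs d)) ∧
      (capRadius re ra rs < d →
        P.real {ω | (d : EReal) < nearestDist re ra rs (Ψ ω)} =
          P.real {ω | Ψ ω (extendedCap re ra rs) = 0} ∧
        P.real {ω | (d : EReal) < nearestDist re ra rs (Ψ ω)} =
          voidFormula lam mu (capAngle re ra rs)) := by
  have hra0 : 0 < ra := hre.trans hra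
  have hrs0 : 0 < rs := hra0.trans hrs
  have h2 : 0 < 2 * rs * ra := by positivity
  have hang0 : 0 ≤ capAngle re ra rs := add_nonneg (Real.arccos_nonneg _) (Real.arccos_nonneg _)
  have hcos0 : 0 ≤ Real.cos (capAngle re ra rs) :=
    Real.cos_nonneg_of_mem_Icc ⟨by linarith [Real.pi_pos], hangle⟩
  have hle : (rs - ra) ^ 2 ≤
      rs ^ 2 + ra ^ 2 - 2 * rs * ra * Real.cos (capAngle re ra rs) := by
    have := mul_le_mul_of_nonneg_left (Real.cos_le_one (capAngle re ra rs)) h2.le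
    linarith
  have hR0 : 0 ≤ capRadius re ra rs := Real.sqrt_nonneg _
  have hRsq : capRadius re ra rs ^ 2 =
      rs ^ 2 + ra ^ 2 - 2 * rs * ra * Real.cos (capAngle re ra rs) :=
    Real.sq_sqrt ((sq_nonneg _).trans hle)
  have hR : rs - ra ≤ capRadius re ra rs := Real.le_sqrt_of_sq_le hle
  have hfull : P.real {ω | Ψ ω (extendedCap re ra rs) = 0} =
      voidFormula lam mu (capAngle re ra rs) :=
    hnet.measureReal_sphericalCap_eq_zero hlam hmu hrs0 hra0 hR0 hang0 hangle (by
      rw [hRsq]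
      field_simp
      ring)
  refine ⟨hnet.aemeasurable_nearestDist re ra, fun d => ⟨fun hd => ?_, fun hd hdR => ?_,
    fun hd => ?_⟩⟩
  -- At `d = rs - ra` the cap has central angle `0` and the formula gives `1`; smaller `d`,
  -- including negative ones, follow by monotonicity.
  · have hbase := hnet.measureReal_coe_lt_nearestDist re ra (rs - ra)
    rw [min_eq_left hR, hnet.measureReal_sphericalCap_eq_zero hlam hmu hrs0 hra0
      (sub_nonneg.2 hrs.le) le_rfl (by positivity) (z := 0) (by
        rw [Real.cos_zero]
        field_simp
        ring), voidFormula_zero] at hbase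
    refine le_antisymm measureReal_le_one (hbase ▸ measureReal_mono fun ω hω => ?_)
    exact (EReal.coe_le_coe_iff.2 hd).trans_lt hω
  · rw [hnet.measureReal_coe_lt_nearestDist, min_eq_left hdR]
    have hd0 : 0 ≤ d := by linarith
    -- The quotient is at least `cos (capAngle re ra rs) ≥ 0`, so `zetaAngle ra rs d ≤ π/2`.
    have hc0 : 0 ≤ (rs ^ 2 + ra ^ 2 - d ^ 2) / (2 * rs * ra) := by
      have h3 := pow_le_pow_left₀ hd0 hdR 2
      have := mul_nonneg h2.le hcos0
      exact div_nonneg (by linarith) h2.le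
    have hc1 : (rs ^ 2 + ra ^ 2 - d ^ 2) / (2 * rs * ra) ≤ 1 := by
      have := pow_le_pow_left₀ (sub_nonneg.2 hrs.le) hd.le 2
      rw [div_le_one h2]
      linarith
    exact hnet.measureReal_sphericalCap_eq_zero hlam hmu hrs0 hra0 hd0 (Real.arccos_nonneg _)
      (Real.arccos_le_pi_div_two.2 hc0) (Real.cos_arccos (by linarith) hc1).symm
  · have h := hnet.measureReal_coe_lt_nearestDist re ra d
    rw [min_eq_right hd.le] at h
    exact ⟨h, h.trans hfull⟩
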